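/- Let $U$ be a universe of separations, that is, a lattice with an order-reversing involution $s\mapsto s^*$, and let $S\subseteq U$ be a finite separation system (a finite subset closed under ${}^*$) that is structurally submodular: for all $s,t\in S$, at least one of $s\vee t$ and $s\wedge t$ lies in $S$. The underlying unoriented separation of $s$ is $\{s,s^*\}$. An orientation of $S$ is a set $O\subseteq S$ that contains exactly one element of each pair $\{s,s^*\}$ with $s\in S$ (so $s\in O$ if $s=s^*\in S$). It is consistent if there are no $r,s\in O$ with $\{r,r^*\}\ne\{s,s^*\}$ and $r^*\le s$. A profile of $S$ is a consistent orientation $P$ of $S$ such that $r^*\wedge s^*\notin P$ for all $r,s\in P$; it is regular if it contains no $s$ with $s^*\le s$. A separation $s$ distinguishes two orientations $O_1,O_2$ if one of $s,s^*$ lies in $O_1$ and its inverse lies in $O_2$. A set $D$ of separations distinguishes two orientations if some element of $D$ does. For a regular profile $P$ of $S$ let $\delta(P)$ be the minimal size of a set $D\subseteq S$ that distinguishes $P$ from every other regular profile of $S$. An $S$-tree $(T,\alpha)$ is a finite tree $T$ together with a map $\alpha$ from the set of oriented edges of $T$ to $S$ with $\alpha(v,u)=\alpha(u,v)^*$. It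 is irredundant if $\alpha(t',t)\neq\alpha(t'',t)$ whenever $t',t''$ are distinct neighbours of a node $t$; it is over stars if $\alpha(t',t)\le \alpha(t'',t)^*$ whenever $t', t''$ are neighbours of a node $t$ with $\alpha(t',t)\ne\alpha(t'',t)$. A tree of tangles for $S$ is an irredundant $S$-tree whose edge labels distinguish every two distinct regular profiles of $S$. A regular profile $P$ of $S$ orients each edge $uv$ of $T$ from $u$ to $v$ if $\alpha(u,v)\in P$. If this orientation has exactly one sink (a node towards which all its incident edges are oriented), this sink is the node of $P$ in $T$, and its degree in $T$ is the degree of $P$ in $(T,\alpha)$. Theorem. There is a tree of tangles $(T,\alpha)$ for $S$, over stars, such that every regular profile $P$ of $S$ has a node in $T$ and the degree of $P$ in $(T,\alpha)$ is exactly $\delta(P)$. Furthermore, if the maximum degree $\Delta(T)$ of $T$ is greater than $3$, then $\Delta(T)=\delta(P)$ for some regular profile $P$ of $S$. -/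

import Mathlib

namespace AbstractSep

/-- A universe of (oriented) separations: a lattice with an order-reversing involution. -/
class SepUniverse (U : Type*) extends Lattice U where
  /-- the inverse of an oriented separation -/
  inv : U → U
  inv_inv : ∀ s : U, inv (inv s) = s
  inv_le_inv : ∀ s t : U, s ≤ t → inv t ≤ inv s

section Separations

variable {U : Type*} [SepUniverse U]

/-- The inverse of an oriented separation. -/
def inv (s : U) : U := SepUniverse.inv s

/-- The underlying unoriented separation of an oriented separation `s`: the pair of `s` and its
inverse. -/
def underlying (s : U) : Sym2 U := s(s, inv s)

/-- `S` is (the set of oriented separations of) a finite separation system inside the universe. -/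
structure IsSepSystem (S : Set U) : Prop where
  finite : S.Finite
  inv_mem : ∀ s ∈ S, inv s ∈ S

/-- Structural submodularity of a separation system inside a universe. -/
def IsStructurallySubmodular (S : Set U) : Prop :=
  ∀ s ∈ S, ∀ t ∈ S, s ⊔ t ∈ S ∨ s ⊓ t ∈ S

/-- A separation is small if it lies below its inverse. -/
def IsSmall (s : U) : Prop := s ≤ inv s

/-- A separation is cosmall if its inverse is small. -/
def IsCosmall (s : U) : Prop := IsSmall (inv s)

/-- A set of oriented separations is regular if it contains no cosmall separation. -/
def IsRegular (O : Set U) : Prop := ∀ s ∈ O, ¬ IsCosmall s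

/-- `O` is an orientation of `S`: an antisymmetric subset of `S` which contains at least one
orientation of every separation in `S`. -/
structure IsOrientation (S O : Set U) : Prop where
  subset : O ⊆ S
  antisymm : ∀ s ∈ S, (O ∩ {s, inv s}).Subsingleton
  total : ∀ s ∈ S, s ∈ O ∨ inv s ∈ O

/-- `O` contains no `r`, `s` with different underlying unoriented separations and
`inv r ≤ s`. -/
def IsConsistent (O : Set U) : Prop :=
  ∀ r ∈ O, ∀ s ∈ O, underlying r ≠ underlying s → ¬ inv r ≤ s

/-- `P` is a profile of `S`: a consistent orientation with the profile property. -/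
structure IsProfile (S P : Set U) : Prop where
  orientation : IsOrientation S P
  consistent : IsConsistent P
  profile : ∀ r ∈ P, ∀ s ∈ P, inv r ⊓ inv s ∉ P

/-- `P` is a regular profile of `S`. -/
structure IsRegularProfile (S P : Set U) : Prop extends IsProfile S P where
  regular : IsRegular P

/-- The separation underlying `s` distinguishes `O₁` and `O₂`: it has an orientation in `O₁`
whose inverse is in `O₂`. -/
def Distinguishes (s : U) (O₁ O₂ : Set U) : Prop :=
  (s ∈ O₁ ∧ inv s ∈ O₂) ∨ (inv s ∈ O₁ ∧ s ∈ O₂)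

/-- `D` is a set of separations in `S` that distinguishes `P` from all other regular profiles
of `S`. -/
def DistinguishesFromOthers (S P D : Set U) : Prop :=
  D ⊆ S ∧ ∀ Q : Set U, IsRegularProfile S Q → Q ≠ P → ∃ s ∈ D, Distinguishes s P Q

/-- `δ(P)`: the minimal size of a set of separations in `S` that distinguishes `P` from all other
regular profiles of `S`. -/
noncomputable def delta (S P : Set U) : ℕ :=
  sInf {n : ℕ | ∃ D : Finset U, D.card = n ∧ DistinguishesFromOthers S P (D : Set U)}

/-- A star: a set of separations whose distinct elements point towards each other. -/
def IsStar (σ : Set U) : Prop := ∀ s ∈ σ, ∀ t ∈ σ, s ≠ t → s ≤ inv t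

/-- An `S`-tree `(T, α)` with vertex set `V`: a tree `T` together with a labelling `α` of the
oriented edges of `T` by elements of `S` which commutes with the involutions. -/
structure STree (S : Set U) (V : Type*) where
  /-- the tree `T` -/
  graph : SimpleGraph V
  isTree : graph.IsTree
  /-- the labelling `α` of the oriented edges -/
  label : graph.Dart → U
  label_mem : ∀ e, label e ∈ S
  label_symm : ∀ e, label e.symm = inv (label e)

namespace STree

variable {S : Set U} {V : Type*} (T : STree S V)

/-- `α(t)`: the set of the labels of the edges at `t`, all directed towards `t`. -/
def labelsAt (t : V) : Set U := {s | ∃ e : T.graph.Dart, e.snd = t ∧ T.label e = s}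

/-- The edges from distinct neighbours of a node to that node have distinct labels. -/
def IsIrredundant : Prop :=
  ∀ e f : T.graph.Dart, e.snd = f.snd → e.fst ≠ f.fst → T.label e ≠ T.label f

/-- All the sets `α(t)` are stars. -/
def IsOverStars : Prop := ∀ t : V, IsStar (T.labelsAt t)

/-- A tree of tangles for `S`: an irredundant `S`-tree whose edge labels distinguish all regular
profiles of `S`. -/
structure IsTreeOfTangles : Prop where
  irredundant : T.IsIrredundant
  distinguishes : ∀ P Q : Set U, IsRegularProfile S P → IsRegularProfile S Q → P ≠ Q →
    ∃ e : T.graph.Dart, Distinguishes (T.label e) P Q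

/-- `t` is a sink of the orientation of the edges of `T` induced by `P` (which directs an edge as
`e` if the label of `e` is in `P`): every edge at `t` is directed towards `t`. -/
def IsSink (P : Set U) (t : V) : Prop := ∀ e : T.graph.Dart, e.snd = t → T.label e ∈ P

/-- `t` is the node of `P` in `T`: the unique sink of the orientation induced by `P`. -/
def IsNodeOf (P : Set U) (t : V) : Prop := T.IsSink P t ∧ ∀ t' : V, T.IsSink P t' → t' = t

open Classical in
/-- The degree of a node of the tree. -/
noncomputable def degree [Fintype V] (t : V) : ℕ := T.graph.degree t

open Classical in
/-- `Δ(T)`: the maximum degree of the tree. -/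
noncomputable def maxDegree [Fintype V] : ℕ := T.graph.maxDegree

end STree

end Separations

end AbstractSep

/-! The proof is a tangle-tree duality argument for the node stars `IsNodeStar`: stars contained in
at most one regular profile, and no larger than `delta S P` if contained in `P`. An irredundant tree
over node stars is already as required. Every regular profile `P` has a unique sink; the star there
lies in `P` and in no other regular profile, so it distinguishes `P` from the others and has size at
least `delta S P`, hence exactly that.

To find such a tree, note that every down-closed orientation contains a node star. If it is not a
regular profile, submodularity yields a star of at most three separations that no regular profile
contains (`isRegularProfile_of_no_isNodeStar`). If it is one, a smallest distinguishing set can be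
uncrossed into a star (`IsRegularProfile.exists_star`).

`Forced S A x` says that a tree with leaves in `A` proves `x`. By induction on the undecided
separations, every partial orientation `A` forces some `x` and `inv x` (`exists_forced_of_partial`):
trees using extra leaves `r` and `q` are shifted onto one separation between `r` and `inv q` and
glued there. For `A = ∅` the two trees form the desired one. -/

namespace AbstractSep

/-! ### Separations, linked separations, and distinguishing stars. -/

section Basics

variable {U : Type*} [SepUniverse U] {S P Q : Set U} {r s t : U}

theorem inv_inv_eq (s : U) : inv (inv s) = s := SepUniverse.inv_inv s

theorem inv_anti (h : s ≤ t) : inv t ≤ inv s := SepUniverse.inv_le_inv s t h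

theorem le_inv_comm : s ≤ inv t ↔ t ≤ inv s :=
  ⟨fun h => by simpa only [inv_inv_eq] using inv_anti h,
    fun h => by simpa only [inv_inv_eq] using inv_anti h⟩

theorem inv_sup (s t : U) : inv (s ⊔ t) = inv s ⊓ inv t :=
  le_antisymm (le_inf (inv_anti le_sup_left) (inv_anti le_sup_right))
    (le_inv_comm.1 (sup_le (le_inv_comm.1 inf_le_left) (le_inv_comm.1 inf_le_right)))

theorem inv_inf (s t : U) : inv (s ⊓ t) = inv s ⊔ inv t := by
  rw [← inv_inv_eq (inv s ⊔ inv t), inv_sup, inv_inv_eq, inv_inv_eq]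

theorem IsSepSystem.inv_mem_iff (hS : IsSepSystem S) : inv s ∈ S ↔ s ∈ S :=
  ⟨fun h => inv_inv_eq s ▸ hS.inv_mem _ h, hS.inv_mem s⟩

theorem isCosmall_iff : IsCosmall s ↔ inv s ≤ s := by
  simp only [IsCosmall, IsSmall, inv_inv_eq]

theorem IsRegularProfile.mem_sep (hP : IsRegularProfile S P) (hs : s ∈ P) : s ∈ S :=
  hP.orientation.subset hs

theorem IsRegularProfile.inv_mem_of_not_mem (hP : IsRegularProfile S P) (hs : s ∈ S)
    (h : s ∉ P) : inv s ∈ P := (hP.orientation.total s hs).resolve_left h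

theorem IsRegularProfile.not_inv_le (hP : IsRegularProfile S P) (hr : r ∈ P) (hs : s ∈ P) :
    ¬ inv r ≤ s := by
  intro h
  by_cases hu : underlying r = underlying s
  · simp only [underlying, Sym2.eq_iff] at hu
    rcases hu with ⟨rfl, -⟩ | ⟨rfl, h2⟩
    · exact hP.regular _ hr (isCosmall_iff.2 h)
    · have := hP.orientation.antisymm s (hP.mem_sep hs) ⟨hs, by simp⟩ ⟨hr, by simp⟩
      exact hP.regular _ hs (isCosmall_iff.2 this.symm.le)
  · exact hP.consistent r hr s hs hu h

theorem IsRegularProfile.inv_not_mem (hP : IsRegularProfile S P) (hs : s ∈ P) : inv s ∉ P :=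
  fun h => hP.not_inv_le hs h le_rfl

theorem IsRegularProfile.mem_of_le (hP : IsRegularProfile S P) (hr : r ∈ S) (hs : s ∈ P)
    (h : r ≤ s) : r ∈ P := by
  by_contra hr'
  exact hP.not_inv_le (hP.inv_mem_of_not_mem hr hr') hs (by rwa [inv_inv_eq])

theorem IsRegularProfile.inv_ne (hP : IsRegularProfile S P) (hs : s ∈ S) : inv s ≠ s := by
  intro h
  rcases hP.orientation.total s hs with h' | h'
  · exact hP.inv_not_mem h' (h.symm ▸ h')
  · exact hP.inv_not_mem h' (by rwa [inv_inv_eq, ← h])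

/-- A profile containing `s` and `r ⊓ inv s` also contains `r`. -/
theorem IsRegularProfile.mem_of_inf_inv_mem (hP : IsRegularProfile S P) (hr : r ∈ S)
    (hs : s ∈ P) (h : r ⊓ inv s ∈ P) : r ∈ P := by
  by_contra h'
  have := hP.profile _ (hP.inv_mem_of_not_mem hr h') s hs
  rw [inv_inv_eq] at this
  exact this h

/-- In an interval of a structurally submodular system there is a separation `s` whose joins with
everything above the lower end, and whose meets with everything below the upper end, are in the
system. -/
theorem exists_linked_separation (hS : S.Finite) (hsub : IsStructurallySubmodular S) {r r' : U}
    (hr : r ∈ S) (hr' : r' ∈ S) (h : r ≤ r') :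
    ∃ s ∈ S, r ≤ s ∧ s ≤ r' ∧ (∀ t ∈ S, r ≤ t → t ⊔ s ∈ S) ∧ ∀ t ∈ S, t ≤ r' → t ⊓ s ∈ S := by
  induction hn : (S ∩ Set.Icc r r').ncard using Nat.strong_induction_on generalizing r r' with
  | _ n ih =>
  subst hn
  have hlt : ∀ {a b : U}, r ≤ a → b ≤ r' → (r ≠ a ∨ b ≠ r') →
      (S ∩ Set.Icc a b).ncard < (S ∩ Set.Icc r r').ncard := by
    intro a b ha hb hab
    refine Set.ncard_lt_ncard ⟨?_, fun hc => ?_⟩ (hS.subset Set.inter_subset_left)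
    · rintro x ⟨hx, h1, h2⟩
      exact ⟨hx, ha.trans h1, h2.trans hb⟩
    · rcases hab with hab | hab
      · exact hab (le_antisymm ha (hc ⟨hr, le_rfl, h⟩).2.1)
      · exact hab (le_antisymm hb (hc ⟨hr', h, le_rfl⟩).2.2)
  by_contra hne
  -- If the separation `a` linked in `[r, v]` is not `r`, a separation linked in `[a, r']` is linked
  -- in `[r, r']` as well, against `hne`. So `a = r`. The claim `high` is dual.
  have low : ∀ v ∈ S, r ≤ v → v ≤ r' → v ≠ r' → ∀ t ∈ S, t ≤ v → t ⊓ r ∈ S := by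
    intro v hv h1 h2 h3
    obtain ⟨a, ha, ha1, ha2, ha3, ha4⟩ := ih _ (hlt le_rfl h2 (.inr h3)) hr hv h1 rfl
    by_cases hra : r = a
    · subst hra; exact ha4
    · exfalso
      obtain ⟨b, hb, hb1, hb2, hb3, hb4⟩ :=
        ih _ (hlt ha1 le_rfl (.inl hra)) ha hr' (ha2.trans h2) rfl
      refine hne ⟨b, hb, ha1.trans hb1, hb2, fun t ht hrt => ?_, hb4⟩
      have := hb3 _ (ha3 t ht hrt) le_sup_right
      rwa [sup_assoc, sup_eq_right.2 hb1] at this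
  have high : ∀ v ∈ S, r ≤ v → v ≤ r' → r ≠ v → ∀ t ∈ S, v ≤ t → t ⊔ r' ∈ S := by
    intro v hv h1 h2 h3
    obtain ⟨a, ha, ha1, ha2, ha3, ha4⟩ := ih _ (hlt h1 le_rfl (.inl h3)) hv hr' h2 rfl
    by_cases hra : a = r'
    · subst hra; exact ha3
    · exfalso
      obtain ⟨b, hb, hb1, hb2, hb3, hb4⟩ :=
        ih _ (hlt le_rfl ha2 (.inr hra)) hr ha (h1.trans ha1) rfl
      refine hne ⟨b, hb, hb1, hb2.trans ha2, hb3, fun t ht hrt => ?_⟩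
      have := hb4 _ (ha4 t ht hrt) inf_le_right
      rwa [inf_assoc, inf_eq_right.2 hb2] at this
  have h1 : ∃ t' ∈ S, t' ≤ r' ∧ t' ⊓ r ∉ S := by
    by_contra! hc
    exact hne ⟨r, hr, le_rfl, h, fun t ht hrt => by rwa [sup_eq_left.2 hrt], hc⟩
  have h2 : ∃ t ∈ S, r ≤ t ∧ t ⊔ r' ∉ S := by
    by_contra! hc
    exact hne ⟨r', hr', h, le_rfl, hc, fun t ht hrt => by rwa [inf_eq_left.2 hrt]⟩
  obtain ⟨t', ht', htr', hn1⟩ := h1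
  obtain ⟨t, ht, htr, hn2⟩ := h2
  have e1 : t' ⊔ r = r' := by
    by_contra hc
    exact hn1 (low _ ((hsub t' ht' r hr).resolve_right hn1) le_sup_right (sup_le htr' h) hc
      t' ht' le_sup_left)
  have e2 : r = t ⊓ r' := by
    by_contra hc
    exact hn2 (high _ ((hsub t ht r' hr').resolve_left hn2) (le_inf htr h) inf_le_right hc
      t ht inf_le_left)
  -- By `e1` and `e2`, the corners of `t` and `t'` are `t ⊔ r'` and `t' ⊓ r`, both missing from `S`.
  rcases hsub t ht t' ht' with h3 | h3
  · apply hn2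
    rwa [← e1, sup_comm t' r, ← sup_assoc, sup_eq_left.2 htr]
  · apply hn1
    rwa [e2, inf_left_comm, inf_eq_left.2 htr']

theorem delta_le_card (D : Finset U)
    (hD : DistinguishesFromOthers S P (D : Set U)) : delta S P ≤ D.card :=
  Nat.sInf_le ⟨D, rfl, hD⟩

/-- A finite set of separations in a regular profile `P` distinguishes `P` from the other regular
profiles if and only if it is contained in no other one. -/
theorem IsRegularProfile.distinguishesFromOthers (hP : IsRegularProfile S P) {D : Finset U}
    (hD : (D : Set U) ⊆ P) (huniq : ∀ Q, IsRegularProfile S Q → (D : Set U) ⊆ Q → Q = P) :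
    DistinguishesFromOthers S P (D : Set U) := by
  refine ⟨fun s hs => hP.mem_sep (hD hs), fun Q hQ hne => ?_⟩
  obtain ⟨s, hs, hs'⟩ := Set.not_subset.1 (fun h => hne (huniq Q hQ h))
  exact ⟨s, hs, .inl ⟨hD hs, hQ.inv_mem_of_not_mem (hP.mem_sep (hD hs)) hs'⟩⟩

open Classical in
theorem IsRegularProfile.exists_subset_card_le_delta (hS : IsSepSystem S)
    (hP : IsRegularProfile S P) :
    ∃ D : Finset U, (D : Set U) ⊆ P ∧ D.card ≤ delta S P ∧
      ∀ Q, IsRegularProfile S Q → (D : Set U) ⊆ Q → Q = P := by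
  -- Nonemptiness ensures that `delta` is attained, not the default value `0` of `sInf`; `P` itself
  -- is a witness.
  have hne : {n : ℕ | ∃ D : Finset U, D.card = n ∧
      DistinguishesFromOthers S P (D : Set U)}.Nonempty := by
    have hfin : P.Finite := hS.finite.subset hP.orientation.subset
    refine ⟨_, hfin.toFinset, rfl, hP.distinguishesFromOthers (by simp) fun Q hQ h => ?_⟩
    rw [Set.Finite.coe_toFinset] at h
    refine (Set.Subset.antisymm h fun s hs => ?_).symm
    by_contra hs'
    exact hQ.inv_not_mem hs (h (hP.inv_mem_of_not_mem (hQ.mem_sep hs) hs'))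
  obtain ⟨D, hD, hDS, hDd⟩ := Nat.sInf_mem hne
  refine ⟨D.image fun s => if s ∈ P then s else inv s, ?_, Finset.card_image_le.trans hD.le, ?_⟩
  · intro x hx
    obtain ⟨s, hs, rfl⟩ := Finset.mem_image.1 (Finset.mem_coe.1 hx)
    split_ifs with h
    · exact h
    · exact hP.inv_mem_of_not_mem (hDS hs) h
  · intro Q hQ hDQ
    by_contra hne
    obtain ⟨s, hs, hd⟩ := hDd Q hQ hne
    have := hDQ (Finset.mem_coe.2 (Finset.mem_image_of_mem _ hs))
    rcases hd with ⟨h1, h2⟩ | ⟨h1, h2⟩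
    · rw [if_pos h1] at this
      exact hQ.inv_not_mem this h2
    · rw [if_neg (fun h => hP.inv_not_mem h h1)] at this
      exact hQ.inv_not_mem h2 this

open Classical in
/-- Every regular profile contains a star of at most `δ(P)` separations that is contained in no
other regular profile. -/
theorem IsRegularProfile.exists_star (hS : IsSepSystem S) (hsub : IsStructurallySubmodular S)
    (hP : IsRegularProfile S P) :
    ∃ D : Finset U, IsStar (D : Set U) ∧ (D : Set U) ⊆ P ∧ D.card ≤ delta S P ∧
      ∀ Q, IsRegularProfile S Q → (D : Set U) ⊆ Q → Q = P := by
  -- Among the optimal sets, one of least total weight is a star: replacing `r` by `r ⊓ inv s`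
  -- lowers the weight, and a profile containing `s` and `r ⊓ inv s` regains `r`.
  let w : U → ℕ := fun x => (S ∩ Set.Iic x).ncard
  have hw : ∀ x y, y ∈ S → x < y → w x < w y := by
    intro x y hy hxy
    refine Set.ncard_lt_ncard ⟨fun z hz => ⟨hz.1, hz.2.trans hxy.le⟩, fun hc => ?_⟩
      (hS.finite.subset Set.inter_subset_left)
    exact hxy.not_ge (hc ⟨hy, le_rfl⟩).2
  let good : Finset U → Prop := fun D => (D : Set U) ⊆ P ∧ D.card ≤ delta S P ∧
      ∀ Q, IsRegularProfile S Q → (D : Set U) ⊆ Q → Q = P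
  have hex : ∃ n, ∃ D, good D ∧ ∑ x ∈ D, w x = n := by
    obtain ⟨D, hD⟩ := hP.exists_subset_card_le_delta hS
    exact ⟨_, D, hD, rfl⟩
  obtain ⟨D, hD, hDn⟩ := Nat.find_spec hex
  have hmin : ∀ D', good D' → ∑ x ∈ D, w x ≤ ∑ x ∈ D', w x := by
    intro D' hD'
    rw [hDn]
    exact Nat.find_min' hex ⟨D', hD', rfl⟩
  have key : ∀ r ∈ D, ∀ s ∈ D, r ≠ s → ¬ r ≤ inv s → r ⊓ inv s ∉ S := by
    intro r hr s hs hrs hle hmem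
    have hsm : s ∈ D.erase r := Finset.mem_erase.2 ⟨hrs.symm, hs⟩
    have hlt : r ⊓ inv s < r := inf_le_left.lt_of_ne fun h => hle (inf_eq_left.1 h)
    have hrS := hP.mem_sep (hD.1 hr)
    have := hmin (insert (r ⊓ inv s) (D.erase r)) ⟨?_, ?_, ?_⟩
    · have h1 : ∑ x ∈ insert (r ⊓ inv s) (D.erase r), w x ≤
          w (r ⊓ inv s) + ∑ x ∈ D.erase r, w x := by
        by_cases h : r ⊓ inv s ∈ D.erase r
        · rw [Finset.insert_eq_of_mem h]; exact Nat.le_add_left _ _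
        · rw [Finset.sum_insert h]
      have h2 := Finset.add_sum_erase D w hr
      have h3 := hw _ _ hrS hlt
      omega
    · intro x hx
      rcases Finset.mem_insert.1 (Finset.mem_coe.1 hx) with rfl | hx
      · exact hP.mem_of_le hmem (hD.1 hr) inf_le_left
      · exact hD.1 (Finset.mem_of_mem_erase hx)
    · refine le_trans ?_ hD.2.1
      have := Finset.card_insert_le (r ⊓ inv s) (D.erase r)
      have := Finset.card_erase_add_one hr
      omega
    · intro Q hQ hDQ
      refine hD.2.2 Q hQ fun x hx => ?_
      by_cases hxr : x = r
      · subst hxr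
        exact hQ.mem_of_inf_inv_mem hrS
          (hDQ (Finset.mem_coe.2 (Finset.mem_insert_of_mem hsm)))
          (hDQ (Finset.mem_coe.2 (Finset.mem_insert_self _ _)))
      · exact hDQ (Finset.mem_coe.2
          (Finset.mem_insert_of_mem (Finset.mem_erase.2 ⟨hxr, hx⟩)))
  refine ⟨D, fun r hr s hs hrs => ?_, hD⟩
  by_contra hle
  rcases hsub r (hP.mem_sep (hD.1 hr)) (inv s) (hS.inv_mem _ (hP.mem_sep (hD.1 hs))) with h | h
  · refine key s hs r hr hrs.symm (fun h' => hle (le_inv_comm.1 h')) ?_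
    have := hS.inv_mem _ h
    rwa [inv_sup, inv_inv_eq, inf_comm] at this
  · exact key r hr s hs hrs hle h

end Basics

/-! ### Tangle-tree duality for node stars. -/

section Duality

variable {U : Type*} [SepUniverse U] {S P Q : Set U} {r s t : U}

/-- The stars which may occur at the nodes of the tree: stars in `S` that are contained in at most
one regular profile, and are of size at most `δ(P)` if they are contained in the regular
profile `P`. -/
structure IsNodeStar (S : Set U) (σ : Finset U) : Prop where
  star : IsStar (σ : Set U)
  subset : (σ : Set U) ⊆ S
  card_le : σ.card ≤ 3 ∨ ∃ P, IsRegularProfile S P ∧ σ.card ≤ delta S P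
  card_le_delta : ∀ P, IsRegularProfile S P → (σ : Set U) ⊆ P → σ.card ≤ delta S P
  unique : ∀ P Q, IsRegularProfile S P → IsRegularProfile S Q → (σ : Set U) ⊆ P →
    (σ : Set U) ⊆ Q → P = Q

theorem IsNodeStar.of_not_subset {σ : Finset U} (h1 : IsStar (σ : Set U)) (h2 : (σ : Set U) ⊆ S)
    (h3 : σ.card ≤ 3) (h4 : ∀ P, IsRegularProfile S P → ¬ (σ : Set U) ⊆ P) : IsNodeStar S σ :=
  ⟨h1, h2, .inl h3, fun P hP h => (h4 P hP h).elim, fun P _ hP _ h => (h4 P hP h).elim⟩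

theorem IsRegularProfile.exists_isNodeStar (hS : IsSepSystem S)
    (hsub : IsStructurallySubmodular S) (hP : IsRegularProfile S P) :
    ∃ σ : Finset U, IsNodeStar S σ ∧ (σ : Set U) ⊆ P := by
  obtain ⟨D, h1, h2, h3, h4⟩ := hP.exists_star hS hsub
  refine ⟨D, ⟨h1, h2.trans hP.orientation.subset, .inr ⟨P, hP, h3⟩, ?_, ?_⟩, h2⟩
  · intro Q hQ hDQ
    rwa [h4 Q hQ hDQ]
  · intro Q R hQ hR hDQ hDR
    rw [h4 Q hQ hDQ, h4 R hR hDR]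

/-- `IsNodeStar S` is preserved by shifting a star with `p ∈ σ` by a separation `s` above
some `r ≤ p`. -/
theorem IsNodeStar.shift [DecidableEq U] (hS : IsSepSystem S) {σ : Finset U}
    (hσ : IsNodeStar S σ) (hs : s ∈ S) (hjoin : ∀ t ∈ S, r ≤ t → t ⊔ s ∈ S) {p : U} (hp : p ∈ σ)
    (hrp : r ≤ p) :
    IsNodeStar S (insert (p ⊔ s) ((σ.erase p).image fun z => z ⊓ inv s)) := by
  have hz : ∀ z ∈ σ, z ≠ p → z ⊓ inv s ∈ S ∧ p ≤ inv z := by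
    intro z hz hzp
    have h1 : p ≤ inv z := hσ.star p hp z hz hzp.symm
    have h2 := hS.inv_mem _ (hjoin _ (hS.inv_mem _ (hσ.subset hz)) (hrp.trans h1))
    rw [inv_sup, inv_inv_eq] at h2
    exact ⟨h2, h1⟩
  have hcard : (insert (p ⊔ s) ((σ.erase p).image fun z => z ⊓ inv s)).card ≤ σ.card := by
    refine (Finset.card_insert_le _ _).trans ?_
    rw [← Finset.card_erase_add_one hp]
    exact Nat.add_le_add_right Finset.card_image_le _
  -- A regular profile containing the shifted star contains `σ`, so uniqueness and the size bounds
  -- are inherited.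
  have hsubset : ∀ P, IsRegularProfile S P →
      ((insert (p ⊔ s) ((σ.erase p).image fun z => z ⊓ inv s) : Finset U) : Set U) ⊆ P →
      (σ : Set U) ⊆ P := by
    intro P hP h
    have h1 : p ⊔ s ∈ P := h (Finset.mem_coe.2 (Finset.mem_insert_self _ _))
    intro z hzσ
    by_cases hzp : z = p
    · subst hzp
      exact hP.mem_of_le (hσ.subset hzσ) h1 le_sup_left
    · refine hP.mem_of_inf_inv_mem (hσ.subset hzσ) (hP.mem_of_le hs h1 le_sup_right) (h ?_)
      exact Finset.mem_coe.2 (Finset.mem_insert_of_mem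
        (Finset.mem_image_of_mem _ (Finset.mem_erase.2 ⟨hzp, hzσ⟩)))
  have hpz : ∀ z ∈ σ, z ≠ p → p ⊔ s ≤ inv (z ⊓ inv s) := by
    intro z hzσ hzp
    rw [inv_inf, inv_inv_eq]
    exact sup_le_sup_right (hz z hzσ hzp).2 s
  refine ⟨?_, ?_, ?_, fun P hP h => hcard.trans (hσ.card_le_delta P hP (hsubset P hP h)),
    fun P Q hP hQ h h' => hσ.unique P Q hP hQ (hsubset P hP h) (hsubset Q hQ h')⟩
  · intro x hx y hy hxy
    simp only [Finset.coe_insert, Set.mem_insert_iff, Finset.mem_coe, Finset.mem_image,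
      Finset.mem_erase] at hx hy
    rcases hx with rfl | ⟨z, ⟨hzp, hzσ⟩, rfl⟩ <;> rcases hy with rfl | ⟨z', ⟨hzp', hzσ'⟩, rfl⟩
    · exact (hxy rfl).elim
    · exact hpz z' hzσ' hzp'
    · exact le_inv_comm.1 (hpz z hzσ hzp)
    · have hne : z ≠ z' := fun h => hxy (by rw [h])
      exact inf_le_left.trans ((hσ.star z hzσ z' hzσ' hne).trans (inv_anti inf_le_left))
  · intro x hx
    simp only [Finset.coe_insert, Set.mem_insert_iff, Finset.mem_coe, Finset.mem_image,
      Finset.mem_erase] at hx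
    rcases hx with rfl | ⟨z, ⟨hzp, hzσ⟩, rfl⟩
    · exact hjoin p (hσ.subset hp) hrp
    · exact (hz z hzσ hzp).1
  · rcases hσ.card_le with h | ⟨P, hP, h⟩
    · exact .inl (hcard.trans h)
    · exact .inr ⟨P, hP, hcard.trans h⟩

/-- `Forced S A x`: there is a finite tree whose nodes are node stars or leaves labelled by elements
of `A`, with a root edge labelled by `x` that points away from the tree. -/
inductive Forced (S A : Set U) : U → Prop
  | leaf {x : U} : x ∈ A → Forced S A x
  | node {x : U} (σ : Finset U) : IsNodeStar S σ → inv x ∈ σ →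
      (∀ y ∈ σ, y ≠ inv x → Forced S A y) → Forced S A x

theorem Forced.mono_of_forced {A B : Set U} (hAB : ∀ x ∈ A, Forced S B x) {x : U}
    (h : Forced S A x) : Forced S B x := by
  induction h with
  | leaf h => exact hAB _ h
  | node σ hσ hx _ ih => exact .node σ hσ hx ih

/-- A single node suffices: no regular profile contains the cosmall `inv r`. -/
theorem forced_of_isSmall {A : Set U} (hr : inv r ∈ S) (h : r ≤ inv r) : Forced S A r := by
  refine .node {inv r} (.of_not_subset ?_ ?_ (by simp) ?_) (by simp) ?_
  · simp [IsStar]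
  · simpa using hr
  · intro P hP hsub
    have : inv r ∈ P := hsub (by simp)
    exact hP.not_inv_le this this (by rwa [inv_inv_eq])
  · intro y hy hne
    exact (hne (by simpa using hy)).elim

open Classical in
-- The whole tree is shifted by `s`. Labels decrease away from the root, so all stay below `inv r`,
-- where the join condition keeps the shifted labels in `S`.
theorem Forced.shift_down (hS : IsSepSystem S) {A : Set U} (hAS : A ⊆ S)
    (hA : ∀ x ∈ S, ∀ y ∈ A, x ≤ y → x ∈ A) (hs : s ∈ S) (hjoin : ∀ t ∈ S, r ≤ t → t ⊔ s ∈ S)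
    {y : U} (hy : Forced S A y) (hyr : y ≤ inv r) : Forced S A (y ⊓ inv s) := by
  induction hy with
  | @leaf x h =>
    refine .leaf (hA _ ?_ _ h inf_le_left)
    have := hS.inv_mem _ (hjoin _ (hS.inv_mem _ (hAS h)) (le_inv_comm.1 hyr))
    rwa [inv_sup, inv_inv_eq] at this
  | @node x σ hσ hx _ ih =>
    have e : inv (x ⊓ inv s) = inv x ⊔ s := by rw [inv_inf, inv_inv_eq]
    refine .node _ (hσ.shift hS hs hjoin hx (le_inv_comm.1 hyr)) ?_ ?_
    · rw [e]; exact Finset.mem_insert_self _ _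
    · intro y hy hne
      rcases Finset.mem_insert.1 hy with h | h
      · exact (hne (h.trans e.symm)).elim
      · obtain ⟨z, hz, rfl⟩ := Finset.mem_image.1 h
        obtain ⟨hzx, hzσ⟩ := Finset.mem_erase.1 hz
        refine ih z hzσ hzx (le_trans ?_ hyr)
        have := hσ.star z hzσ _ hx hzx
        rwa [inv_inv_eq] at this

open Classical in
-- If the leaf `r` is needed, it is needed in just one branch at each node, as `r` is not small. The
-- second alternative re-roots the shifted tree at that leaf: a tree for `inv x ⊓ inv s`, attached
-- at the old root, completes a tree for `inv s`.
theorem Forced.of_insert (hS : IsSepSystem S) {A : Set U} (hAS : A ⊆ S)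
    (hA : ∀ x ∈ S, ∀ y ∈ A, x ≤ y → x ∈ A) (hs : s ∈ S) (hjoin : ∀ t ∈ S, r ≤ t → t ⊔ s ∈ S)
    (hrs : r ≤ s) (hr : ¬ r ≤ inv r) {x : U} (hx : Forced S (insert r A) x) :
    Forced S A x ∨ (r ≤ x ∧ (Forced S A (inv x ⊓ inv s) → Forced S A (inv s))) := by
  induction hx with
  | @leaf x h =>
    rcases h with rfl | h
    · refine .inr ⟨le_rfl, fun h => ?_⟩
      rwa [inf_eq_right.2 (inv_anti hrs)] at h
    · exact .inl (.leaf h)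
  | @node x σ hσ hx _ ih =>
    by_cases hall : ∀ y ∈ σ, y ≠ inv x → Forced S A y
    · exact .inl (.node σ hσ hx hall)
    · push Not at hall
      obtain ⟨y, hy, hyx, hny⟩ := hall
      obtain ⟨hry, hy'⟩ := (ih y hy hyx).resolve_left hny
      refine .inr ⟨hry.trans ?_, fun hxs => hy' ?_⟩
      · have := hσ.star y hy _ hx hyx
        rwa [inv_inv_eq] at this
      have e : inv (inv y ⊓ inv s) = y ⊔ s := by rw [inv_inf, inv_inv_eq, inv_inv_eq]
      refine .node _ (hσ.shift hS hs hjoin hy hry) ?_ ?_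
      · rw [e]; exact Finset.mem_insert_self _ _
      · intro z' hz' hne
        rcases Finset.mem_insert.1 hz' with h | h
        · exact (hne (h.trans e.symm)).elim
        · obtain ⟨z, hz, rfl⟩ := Finset.mem_image.1 h
          obtain ⟨hzy, hzσ⟩ := Finset.mem_erase.1 hz
          by_cases hzx : z = inv x
          · rw [hzx]; exact hxs
          have hyz : y ≤ inv z := hσ.star y hy z hzσ (Ne.symm hzy)
          refine Forced.shift_down hS hAS hA hs hjoin ?_ (le_inv_comm.1 (hry.trans hyz))
          refine (ih z hzσ hzx).resolve_right fun h => hr ?_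
          exact (hry.trans hyz).trans (inv_anti h.1)

/-- A contradiction that uses a leaf `r` shows that the inverse of a separation linked to `r` is
forced. -/
theorem forced_inv_of_insert (hS : IsSepSystem S) {A : Set U} (hAS : A ⊆ S)
    (hA : ∀ x ∈ S, ∀ y ∈ A, x ≤ y → x ∈ A) (hr : r ∈ S) (hs : s ∈ S)
    (hjoin : ∀ t ∈ S, r ≤ t → t ⊔ s ∈ S) (hrs : r ≤ s)
    (h : ∃ x, Forced S (insert r A) x ∧ Forced S (insert r A) (inv x)) :
    (∃ x, Forced S A x ∧ Forced S A (inv x)) ∨ Forced S A (inv s) := by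
  by_cases hsm : r ≤ inv r
  · have : ∀ x ∈ insert r A, Forced S A x := by
      rintro x (rfl | hx)
      · exact forced_of_isSmall (hS.inv_mem _ hr) hsm
      · exact .leaf hx
    obtain ⟨x, h1, h2⟩ := h
    exact .inl ⟨x, h1.mono_of_forced this, h2.mono_of_forced this⟩
  have key : ∀ x, Forced S A (inv x) → r ≤ x →
      (Forced S A (inv x ⊓ inv s) → Forced S A (inv s)) → Forced S A (inv s) :=
    fun x h1 h2 h3 => h3 (h1.shift_down hS hAS hA hs hjoin (inv_anti h2))
  obtain ⟨x, h1, h2⟩ := h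
  rcases h1.of_insert hS hAS hA hs hjoin hrs hsm with h1 | ⟨h1, h1'⟩ <;>
    rcases h2.of_insert hS hAS hA hs hjoin hrs hsm with h2 | ⟨h2, h2'⟩
  · exact .inl ⟨x, h1, h2⟩
  · exact .inr (key (inv x) (by rwa [inv_inv_eq]) h2 h2')
  · exact .inr (key x h2 h1 h1')
  -- If both trees needed the leaf, then `r ≤ x ≤ inv r`, so `r` would be small.
  · exact (hsm (h1.trans (le_inv_comm.1 h2))).elim

open Classical in
/-- A down-closed orientation of `S` that contains no node star is a regular profile. -/
theorem isRegularProfile_of_no_isNodeStar (hS : IsSepSystem S)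
    (hsub : IsStructurallySubmodular S) {A : Set U} (hAS : A ⊆ S)
    (hA : ∀ x ∈ S, ∀ y ∈ A, x ≤ y → x ∈ A) (hanti : ∀ x ∈ A, inv x ∉ A)
    (htot : ∀ x ∈ S, x ∈ A ∨ inv x ∈ A) (hno : ∀ σ, IsNodeStar S σ → ¬ (σ : Set U) ⊆ A) :
    IsRegularProfile S A := by
  have hle : ∀ r ∈ A, ∀ s ∈ A, ¬ inv r ≤ s := fun r hr s hs h =>
    hanti r hr (hA _ (hS.inv_mem _ (hAS hr)) _ hs h)
  have key : ∀ r ∈ A, ∀ s ∈ A, inv r ⊓ inv s ∈ A → r ⊓ inv s ∉ S := by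
    intro r hr s hs hw hmem
    -- A profile containing this star would contain `r` and `s`, and so violate the profile
    -- property.
    refine hno {r ⊓ inv s, s, inv r ⊓ inv s}
      (.of_not_subset ?_ ?_ Finset.card_le_three ?_) ?_
    · have h1 : r ⊓ inv s ≤ inv s := inf_le_right
      have h2 : inv r ⊓ inv s ≤ inv s := inf_le_right
      have h3 : r ⊓ inv s ≤ inv (inv r ⊓ inv s) := by
        rw [inv_inf, inv_inv_eq]
        exact inf_le_left.trans le_sup_left
      intro x hx y hy hxy
      simp only [Finset.coe_insert, Finset.coe_singleton, Set.mem_insert_iff,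
        Set.mem_singleton_iff] at hx hy
      rcases hx with rfl | rfl | rfl <;> rcases hy with rfl | rfl | rfl
      · exact (hxy rfl).elim
      · exact h1
      · exact h3
      · exact le_inv_comm.1 h1
      · exact (hxy rfl).elim
      · exact le_inv_comm.1 h2
      · exact le_inv_comm.1 h3
      · exact h2
      · exact (hxy rfl).elim
    · intro x hx
      simp only [Finset.coe_insert, Finset.coe_singleton, Set.mem_insert_iff,
        Set.mem_singleton_iff] at hx
      rcases hx with rfl | rfl | rfl
      · exact hmem
      · exact hAS hs
      · exact hAS hw
    · intro P hP h
      simp only [Finset.coe_insert, Finset.coe_singleton, Set.insert_subset_iff,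
        Set.singleton_subset_iff] at h
      exact hP.profile r (hP.mem_of_inf_inv_mem (hAS hr) h.2.1 h.1) s h.2.1 h.2.2
    · simp only [Finset.coe_insert, Finset.coe_singleton, Set.insert_subset_iff,
        Set.singleton_subset_iff]
      exact ⟨hA _ hmem _ hr inf_le_left, hs, hw⟩
  refine ⟨⟨⟨hAS, ?_, htot⟩, fun r hr s hs _ => hle r hr s hs, ?_⟩,
    fun s hs h => hle s hs s hs (isCosmall_iff.1 h)⟩
  · rintro s - x ⟨hx, rfl | rfl⟩ y ⟨hy, rfl | rfl⟩
    · rfl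
    · exact (hanti _ hx hy).elim
    · exact (hanti _ hy hx).elim
    · rfl
  · intro r hr s hs hw
    rcases hsub r (hAS hr) (inv s) (hS.inv_mem _ (hAS hs)) with h | h
    · refine key s hs r hr (by rwa [inf_comm]) ?_
      have := hS.inv_mem _ h
      rwa [inv_sup, inv_inv_eq, inf_comm] at this
    · exact key r hr s hs hw h

theorem exists_minimal_undecided (hS : IsSepSystem S) {A : Set U} (hs : s ∈ S) (h1 : s ∉ A)
    (h2 : inv s ∉ A) : ∃ r ∈ S, r ≤ s ∧ r ∉ A ∧ inv r ∉ A ∧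
      ∀ t ∈ S, t < r → t ∈ A ∨ inv t ∈ A := by
  have hfin : {r ∈ S | r ≤ s ∧ r ∉ A ∧ inv r ∉ A}.Finite := hS.finite.subset fun x hx => hx.1
  obtain ⟨r, hr⟩ := hfin.exists_minimal ⟨s, hs, le_rfl, h1, h2⟩
  refine ⟨r, hr.prop.1, hr.prop.2.1, hr.prop.2.2.1, hr.prop.2.2.2, fun t ht htr => ?_⟩
  by_contra! hc
  exact htr.not_ge (hr.le_of_le ⟨ht, htr.le.trans hr.prop.2.1, hc⟩ htr.le)

theorem exists_forced_of_partial (hS : IsSepSystem S) (hsub : IsStructurallySubmodular S)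
    (hnd : ∀ s ∈ S, inv s ≠ s) (hne : ∀ σ, IsNodeStar S σ → σ.Nonempty)
    (A : Set U) (hAS : A ⊆ S)
    (hA : ∀ x ∈ S, ∀ y ∈ A, x ≤ y → x ∈ A) (hanti : ∀ x ∈ A, inv x ∉ A) :
    ∃ x, Forced S A x ∧ Forced S A (inv x) := by
  induction hn : (S \ A).ncard using Nat.strong_induction_on generalizing A with
  | _ n ih =>
  subst hn
  have hins : ∀ r ∈ S, r ∉ A → inv r ∉ A → (∀ t ∈ S, t < r → t ∈ A ∨ inv t ∈ A) →
      ∃ x, Forced S (insert r A) x ∧ Forced S (insert r A) (inv x) := by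
    intro r hr h1 h2 h3
    refine ih _ ?_ (insert r A) (Set.insert_subset hr hAS) ?_ ?_ rfl
    · refine Set.ncard_lt_ncard ⟨fun x hx => ⟨hx.1, fun h => hx.2 (.inr h)⟩, fun hc => ?_⟩
        hS.finite.sdiff
      exact (hc ⟨hr, h1⟩).2 (.inl rfl)
    · rintro x hx y (rfl | hy) hxy
      · rcases hxy.eq_or_lt with rfl | hlt
        · exact .inl rfl
        · refine .inr ((h3 x hx hlt).resolve_right fun h => h2 ?_)
          exact hA _ (hS.inv_mem _ hr) _ h (inv_anti hxy)
      · exact .inr (hA x hx y hy hxy)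
    · rintro x (rfl | hx) (h | h)
      · exact hnd _ hr h
      · exact h2 h
      · rw [← h, inv_inv_eq] at h2
        exact h2 hx
      · exact hanti x hx h
  by_cases htot : ∀ x ∈ S, x ∈ A ∨ inv x ∈ A
  · have : ∃ σ, IsNodeStar S σ ∧ (σ : Set U) ⊆ A := by
      by_contra! hno
      obtain ⟨σ, h1, h2⟩ := (isRegularProfile_of_no_isNodeStar hS hsub hAS hA hanti htot
        hno).exists_isNodeStar hS hsub
      exact hno σ h1 h2
    obtain ⟨σ, hσ, hσA⟩ := this
    obtain ⟨x, hx⟩ := hne σ hσ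
    exact ⟨x, .leaf (hσA hx), .node σ hσ (by rwa [inv_inv_eq]) fun y hy _ => .leaf (hσA hy)⟩
  · push Not at htot
    obtain ⟨s, hs, hs1, hs2⟩ := htot
    -- Minimality keeps `A` down-closed when `r` or `q` is added. The linked `a` then serves both:
    -- adding `r` leads to `inv a`, adding `q` leads to `a`.
    obtain ⟨r, hr, hrs, hr1, hr2, hr3⟩ := exists_minimal_undecided hS hs hs1 hs2
    obtain ⟨q, hq, hqr, hq1, hq2, hq3⟩ := exists_minimal_undecided hS (hS.inv_mem _ hr) hr2
      (by rwa [inv_inv_eq])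
    obtain ⟨a, ha, hra, haq, hjoin, hmeet⟩ := exists_linked_separation hS.finite hsub hr
      (hS.inv_mem _ hq) (le_inv_comm.1 hqr)
    rcases forced_inv_of_insert hS hAS hA hr ha hjoin hra (hins r hr hr1 hr2 hr3) with h | h1
    · exact h
    have hjoin' : ∀ t ∈ S, q ≤ t → t ⊔ inv a ∈ S := by
      intro t ht hqt
      have := hS.inv_mem _ (hmeet _ (hS.inv_mem _ ht) (inv_anti hqt))
      rwa [inv_inf, inv_inv_eq] at this
    rcases forced_inv_of_insert hS hAS hA hq (hS.inv_mem _ ha) hjoin' (le_inv_comm.1 haq)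
      (hins q hq hq1 hq2 hq3) with h | h2
    · exact h
    · exact ⟨a, by rwa [inv_inv_eq] at h2, h1⟩

theorem exists_isNodeStar_forall_forced (hS : IsSepSystem S) (hsub : IsStructurallySubmodular S) :
    ∃ σ, IsNodeStar S σ ∧ ∀ x ∈ σ, Forced S ∅ x := by
  -- The empty star lies in every regular profile, so it is a node star exactly if there is at most
  -- one; a one-node tree then suffices.
  by_cases h : IsNodeStar S ∅
  · exact ⟨∅, h, by simp⟩
  have hne : ∀ σ, IsNodeStar S σ → σ.Nonempty := fun σ hσ =>
    Finset.nonempty_iff_ne_empty.2 fun h' => h (h' ▸ hσ)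
  have hP : ∃ P, IsRegularProfile S P := by
    by_contra! hc
    exact h (.of_not_subset (by simp [IsStar]) (by simp) (by simp) fun P hP => (hc P hP).elim)
  obtain ⟨P, hP⟩ := hP
  obtain ⟨x, h1, h2⟩ := exists_forced_of_partial hS hsub (fun s hs => hP.inv_ne hs) hne ∅
    (by simp) (by simp) (by simp)
  cases h1 with
  | leaf h => exact h.elim
  | node σ hσ hx hy =>
    refine ⟨σ, hσ, fun y hyσ => ?_⟩
    by_cases hyx : y = inv x
    · rwa [hyx]
    · exact hy y hyσ hyx

end Duality

/-! ### From forced separations to an `S`-tree. -/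

section Trees

variable {U : Type*} [SepUniverse U] {S P Q : Set U} {r s t : U}

/-- A rooted tree of separations, given by the set `L` of the label sequences of the paths from its
nodes to the root. The separations at the root are those in `τ`, and the separations at every other
node form a node star. -/
structure IsNodeForest (S : Set U) (τ : Finset U) (L : Finset (List U)) : Prop where
  nil_mem : [] ∈ L
  tail_mem : ∀ y l, y :: l ∈ L → l ∈ L
  root : ∀ y, [y] ∈ L ↔ y ∈ τ
  node : ∀ h l, h :: l ∈ L → ∃ σ, IsNodeStar S σ ∧ inv h ∈ σ ∧
    ∀ y, y :: h :: l ∈ L ↔ y ∈ σ ∧ y ≠ inv h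

open Classical in
theorem exists_isNodeForest_of_forall (τ : Finset U)
    (h : ∀ y ∈ τ, ∃ σ L, IsNodeStar S σ ∧ inv y ∈ σ ∧ IsNodeForest S (σ.erase (inv y)) L) :
    ∃ L, IsNodeForest S τ L := by
  choose! σ L hσ hy hL using h
  have hmem : ∀ l, l ∈ insert [] (τ.biUnion fun y => (L y).image (· ++ [y])) ↔
      l = [] ∨ ∃ y ∈ τ, ∃ l' ∈ L y, l' ++ [y] = l := by
    intro l
    simp only [Finset.mem_insert, Finset.mem_biUnion, Finset.mem_image]
  have hmem' : ∀ y l, l ++ [y] ∈ insert [] (τ.biUnion fun y => (L y).image (· ++ [y])) ↔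
      y ∈ τ ∧ l ∈ L y := by
    intro y l
    rw [hmem]
    constructor
    · rintro (h | ⟨z, hz, l', hl', e⟩)
      · simp at h
      · obtain ⟨rfl, e⟩ := List.append_inj' e rfl
        obtain rfl : z = y := by simpa using e
        exact ⟨hz, hl'⟩
    · exact fun h => .inr ⟨y, h.1, l, h.2, rfl⟩
  refine ⟨_, (hmem []).2 (.inl rfl), fun y l hl => ?_, fun y => ?_, fun x l hl => ?_⟩
  · rcases List.eq_nil_or_concat' l with rfl | ⟨l, z, rfl⟩
    · exact (hmem []).2 (.inl rfl)
    · rw [← List.cons_append, hmem'] at hl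
      exact (hmem' _ _).2 ⟨hl.1, (hL z hl.1).tail_mem y l hl.2⟩
  · rw [← List.nil_append [y], hmem']
    exact ⟨fun h => h.1, fun h => ⟨h, (hL y h).nil_mem⟩⟩
  · rcases List.eq_nil_or_concat' l with rfl | ⟨l, z, rfl⟩
    · rw [← List.nil_append [x], hmem'] at hl
      refine ⟨σ x, hσ x hl.1, hy x hl.1, fun y => ?_⟩
      rw [show y :: [x] = [y] ++ [x] from rfl, hmem', (hL x hl.1).root, Finset.mem_erase]
      tauto
    · rw [← List.cons_append, hmem'] at hl
      obtain ⟨ρ, h1, h2, h3⟩ := (hL z hl.1).node x l hl.2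
      refine ⟨ρ, h1, h2, fun y => ?_⟩
      rw [← List.cons_append, ← List.cons_append, hmem', h3]
      tauto

theorem Forced.exists_isNodeForest [DecidableEq U] {x : U} (h : Forced S ∅ x) :
    ∃ σ L, IsNodeStar S σ ∧ inv x ∈ σ ∧ IsNodeForest S (σ.erase (inv x)) L := by
  classical
  induction h with
  | leaf h => exact h.elim
  | @node x σ hσ hx _ ih =>
    obtain ⟨L, hL⟩ := exists_isNodeForest_of_forall (S := S) (σ.erase (inv x)) fun y hy => by
      obtain ⟨h1, h2⟩ := Finset.mem_erase.1 hy
      convert ih y h2 h1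
    refine ⟨σ, L, hσ, hx, ?_⟩
    convert hL

section ListTree

variable {V α : Type*}

/-- The graph on a set of nodes given by lists, in which every list is adjacent to its tail. -/
def listGraph (f : V → List α) : SimpleGraph V where
  Adj u v := (∃ h, f u = h :: f v) ∨ ∃ h, f v = h :: f u
  symm := ⟨fun _ _ h => h.symm⟩
  loopless := ⟨fun u h => by
    rcases h with ⟨h, e⟩ | ⟨h, e⟩ <;> simpa using congrArg List.length e⟩

theorem listGraph_isTree (f : V → List α) (hf : Function.Injective f) (hnil : [] ∈ Set.range f)
    (htail : ∀ h l, h :: l ∈ Set.range f → l ∈ Set.range f) : (listGraph f).IsTree := by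
  obtain ⟨v₀, hv₀⟩ := hnil
  have hreach : ∀ l v, f v = l → (listGraph f).Reachable v v₀ := by
    intro l
    induction l with
    | nil =>
      intro v hv
      rw [hf (hv.trans hv₀.symm)]
    | cons h l ih =>
      intro v hv
      obtain ⟨w, hw⟩ := htail h l ⟨v, hv⟩
      have : (listGraph f).Adj v w := .inl ⟨h, by rw [hv, hw]⟩
      exact this.reachable.trans (ih w hw)
  have hcon : (listGraph f).Connected :=
    { preconnected := fun u v => (hreach _ u rfl).trans (hreach _ v rfl).symm
      nonempty := ⟨v₀⟩ }
  refine ⟨hcon, SimpleGraph.isAcyclic_iff_forall_isBridge.2 ?_⟩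
  have hb : ∀ u v h, f u = h :: f v → (listGraph f).IsBridge s(u, v) := by
    intro u v h huv
    rw [SimpleGraph.isBridge_iff]
    rintro ⟨p⟩
    -- Without the edge to its tail, a walk from `u` cannot leave the lists with suffix `f u`.
    have : ∀ w w' : V, ((listGraph f).deleteEdges {s(u, v)}).Walk w w' →
        f u <:+ f w → f u <:+ f w' := by
      intro w w' p
      induction p with
      | nil => exact id
      | @cons a b c hab _ ih =>
        intro ha
        apply ih
        obtain ⟨⟨x, hx⟩ | ⟨x, hx⟩, hne⟩ := (SimpleGraph.deleteEdges_adj).1 hab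
        · rw [hx, List.suffix_cons_iff] at ha
          refine ha.resolve_left fun e => hne ?_
          have h1 : u = a := hf (e.trans hx.symm)
          have h2 : v = b := by
            apply hf
            rw [huv] at e
            exact (List.cons.inj e).2
          rw [h1, h2]; rfl
        · rw [hx]
          exact ha.trans (List.suffix_cons x _)
    have := (this u v p List.suffix_rfl).length_le
    rw [huv, List.length_cons] at this
    omega
  intro e
  induction e with
  | _ u v =>
  rintro (⟨h, huv⟩ | ⟨h, huv⟩)
  · exact hb u v h huv
  · rw [Sym2.eq_swap]
    exact hb v u h huv

end ListTree

open Classical in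
theorem exists_sTree_of_isNodeForest (hS : IsSepSystem S) {τ : Finset U} (hτ : IsNodeStar S τ)
    {L : Finset (List U)} (hL : IsNodeForest S τ L) :
    ∃ (V : Type) (_ : Fintype V) (T : STree S V), T.IsIrredundant ∧
      ∀ v, ∃ σ : Finset U, IsNodeStar S σ ∧ T.labelsAt v = σ := by
  -- Numbering the nodes puts them in `Type`, whatever the universe of `U`.
  obtain ⟨e⟩ : Nonempty (Fin L.card ≃ L) := ⟨L.equivFin.symm⟩
  let f : Fin L.card → List U := fun i => e i
  have hf : Function.Injective f := Subtype.val_injective.comp e.injective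
  have hfL : ∀ l, l ∈ Set.range f ↔ l ∈ L := fun l =>
    ⟨by rintro ⟨i, rfl⟩; exact (e i).2, fun h => ⟨e.symm ⟨l, h⟩, by simp [f]⟩⟩
  have hfmem : ∀ i, f i ∈ L := fun i => (e i).2
  have hex : ∀ l ∈ L, ∃ i, f i = l := fun l hl => (hfL l).2 hl
  have hS' : ∀ x l, x :: l ∈ L → x ∈ S := by
    intro x l hx
    obtain ⟨σ, h1, h2, -⟩ := hL.node x l hx
    exact hS.inv_mem_iff.1 (h1.subset h2)
  let label : (listGraph f).Dart → U := fun d =>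
    if h : ∃ x, f d.fst = x :: f d.snd then h.choose else inv (d.adj.resolve_left h).choose
  have hup : ∀ d x, f d.fst = x :: f d.snd → label d = x := by
    intro d x hx
    have h : ∃ x, f d.fst = x :: f d.snd := ⟨x, hx⟩
    simp only [label, dif_pos h]
    exact (List.cons.inj (h.choose_spec.symm.trans hx)).1
  have hdown : ∀ d x, f d.snd = x :: f d.fst → label d = inv x := by
    intro d x hx
    have h : ¬ ∃ x, f d.fst = x :: f d.snd := by
      rintro ⟨y, hy⟩
      have h1 := congrArg List.length hx
      have h2 := congrArg List.length hy
      simp only [List.length_cons] at h1 h2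
      omega
    simp only [label, dif_neg h]
    exact congrArg inv (List.cons.inj ((d.adj.resolve_left h).choose_spec.symm.trans hx)).1
  let T : STree S (Fin L.card) :=
    { graph := listGraph f
      isTree := listGraph_isTree f hf ((hfL _).2 hL.nil_mem) fun h l hl =>
        (hfL _).2 (hL.tail_mem h l ((hfL _).1 hl))
      label := label
      label_mem := by
        intro d
        rcases d.adj with ⟨x, hx⟩ | ⟨x, hx⟩
        · rw [hup d x hx]
          exact hS' x _ (hx ▸ hfmem _)
        · rw [hdown d x hx]
          exact hS.inv_mem _ (hS' x _ (hx ▸ hfmem _))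
      label_symm := by
        intro d
        rcases d.adj with ⟨x, hx⟩ | ⟨x, hx⟩
        · rw [hup d x hx, hdown d.symm x hx]
        · rw [hdown d x hx, hup d.symm x hx, inv_inv_eq] }
  have hback : ∀ v x y, y :: f v ∈ L → (∃ w, f v = x :: f w) → y ≠ inv x := by
    rintro v x y hy ⟨w, hw⟩
    obtain ⟨σ, -, -, h3⟩ := hL.node x (f w) (hw ▸ hfmem v)
    rw [hw] at hy
    exact ((h3 y).1 hy).2
  refine ⟨Fin L.card, inferInstance, T, ?_, ?_⟩
  · intro a b hab hne heq
    change label a = label b at heq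
    rcases a.adj with ⟨x, hx⟩ | ⟨x, hx⟩ <;> rcases b.adj with ⟨y, hy⟩ | ⟨y, hy⟩
    · rw [hup a x hx, hup b y hy] at heq
      exact hne (hf (by rw [hx, hy, hab, heq]))
    · rw [hup a x hx, hdown b y hy] at heq
      exact hback b.snd y x (by rw [← hab, ← hx]; exact hfmem _) ⟨_, hy⟩ heq
    · rw [hdown a x hx, hup b y hy] at heq
      exact hback a.snd x y (by rw [hab, ← hy]; exact hfmem _) ⟨_, hx⟩ heq.symm
    · rw [hab] at hx
      exact hne (hf (List.cons.inj (hx.symm.trans hy)).2)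
  · intro v
    have hchild : ∀ y, y :: f v ∈ L → y ∈ T.labelsAt v := by
      intro y hy
      obtain ⟨u, hu⟩ := hex _ hy
      exact ⟨⟨(u, v), .inl ⟨y, hu⟩⟩, rfl, hup ⟨(u, v), .inl ⟨y, hu⟩⟩ y hu⟩
    cases hv : f v with
    | nil =>
      rw [hv] at hchild
      refine ⟨τ, hτ, Set.Subset.antisymm ?_ fun y hy => hchild y ((hL.root y).2 hy)⟩
      rintro s ⟨d, rfl, rfl⟩
      change label d ∈ _
      rcases d.adj with ⟨x, hx⟩ | ⟨x, hx⟩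
      · rw [hup d x hx, Finset.mem_coe, ← hL.root, ← hv, ← hx]
        exact hfmem _
      · rw [hv] at hx
        exact (List.cons_ne_nil _ _ hx.symm).elim
    | cons h l =>
      rw [hv] at hchild
      have hl : h :: l ∈ L := hv ▸ hfmem v
      obtain ⟨σ, h1, h2, h3⟩ := hL.node h l hl
      refine ⟨σ, h1, Set.Subset.antisymm ?_ fun y hy => ?_⟩
      · rintro s ⟨d, rfl, rfl⟩
        change label d ∈ _
        rcases d.adj with ⟨x, hx⟩ | ⟨x, hx⟩
        · rw [hup d x hx]
          refine ((h3 x).1 ?_).1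
          rw [← hv, ← hx]
          exact hfmem _
        · rw [hdown d x hx, ← (List.cons.inj (hv.symm.trans hx)).1]
          exact h2
      · by_cases hyh : y = inv h
        · obtain ⟨w, hw⟩ := hex l (hL.tail_mem h l hl)
          have hvw : f v = h :: f w := by rw [hv, hw]
          rw [hyh]
          exact ⟨⟨(w, v), .inr ⟨h, hvw⟩⟩, rfl, hdown ⟨(w, v), .inr ⟨h, hvw⟩⟩ h hvw⟩
        · exact hchild y ((h3 y).2 ⟨hy, hyh⟩)

namespace STree

variable {V : Type*} (T : STree S V)

/-- Otherwise each node has an outgoing edge. No edge is directed both ways, so these are distinct: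
too many edges for a tree. -/
theorem exists_isSink [Fintype V] (hP : IsRegularProfile S P) : ∃ t, T.IsSink P t := by
  classical
  by_contra! hc
  have hout : ∀ t, ∃ u, ∃ h : T.graph.Adj t u, T.label ⟨(t, u), h⟩ ∈ P := by
    intro t
    have := hc t
    unfold IsSink at this
    push Not at this
    obtain ⟨⟨⟨u, v⟩, huv⟩, rfl, he⟩ := this
    refine ⟨u, huv.symm, ?_⟩
    have := hP.inv_mem_of_not_mem (T.label_mem _) he
    rwa [← T.label_symm] at this
  choose f hadj hf using hout
  have hcard : Fintype.card V ≤ T.graph.edgeFinset.card := by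
    refine Finset.card_le_card_of_injOn (fun v => s(v, f v)) (fun v _ => ?_) fun v _ w _ h => ?_
    · exact Finset.mem_coe.2 (SimpleGraph.mem_edgeFinset.2 (hadj v))
    · rcases Sym2.eq_iff.1 h with ⟨h, -⟩ | ⟨h1, h2⟩
      · exact h
      · exfalso
        have h3 : (⟨(w, f w), hadj w⟩ : T.graph.Dart) =
            (⟨(v, f v), hadj v⟩ : T.graph.Dart).symm :=
          SimpleGraph.Dart.ext _ _ (Prod.ext h2.symm h1.symm)
        refine hP.inv_not_mem (hf v) ?_
        rw [← T.label_symm, ← h3]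
        exact hf w
  have := T.isTree.card_edgeFinset
  omega

/-- Stars and irredundancy make the labels increase along a path, so membership in `P` passes back
from the sink. -/
theorem label_mem_of_isSink (hirr : T.IsIrredundant) (hstar : T.IsOverStars)
    (hP : IsRegularProfile S P) {u v w : V} (huv : T.graph.Adj u v) (p : T.graph.Walk v w)
    (hp : (SimpleGraph.Walk.cons huv p).IsPath) (hw : T.IsSink P w) :
    T.label ⟨(u, v), huv⟩ ∈ P := by
  induction p generalizing u with
  | nil => exact hw _ rfl
  | @cons a b c hab p ih =>
    have hub : u ≠ b := by
      rintro rfl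
      rw [SimpleGraph.Walk.cons_isPath_iff] at hp
      exact hp.2 (by simp)
    refine hP.mem_of_le (T.label_mem _) (ih hab hp.of_cons hw) ?_
    have h1 := hirr ⟨(u, a), huv⟩ ⟨(b, a), hab.symm⟩ rfl hub
    have h2 := hstar a _ ⟨⟨(u, a), huv⟩, rfl, rfl⟩ _ ⟨⟨(b, a), hab.symm⟩, rfl, rfl⟩ h1
    rwa [← T.label_symm] at h2

theorem isSink_unique (hirr : T.IsIrredundant) (hstar : T.IsOverStars)
    (hP : IsRegularProfile S P) {t t' : V} (ht : T.IsSink P t) (ht' : T.IsSink P t') : t' = t := by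
  obtain ⟨p, hp⟩ := (T.isTree.1.preconnected t t').exists_isPath
  cases p with
  | nil => rfl
  | @cons _ v _ htv p =>
    have h1 := T.label_mem_of_isSink hirr hstar hP htv p hp ht'
    have h2 := ht ⟨(v, t), htv.symm⟩ rfl
    have h3 := T.label_symm ⟨(t, v), htv⟩
    exact (hP.inv_not_mem h1 (h3 ▸ h2)).elim

theorem degree_eq_card [Fintype V] (hirr : T.IsIrredundant) {t : V} {σ : Finset U}
    (hσ : T.labelsAt t = σ) : T.degree t = σ.card := by
  classical
  rw [degree, ← SimpleGraph.card_neighborFinset_eq_degree]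
  refine Finset.card_bij (fun u hu => T.label ⟨(u, t), ((T.graph.mem_neighborFinset t u).1 hu).symm⟩)
    ?_ ?_ ?_
  · intro u hu
    rw [← Finset.mem_coe, ← hσ]
    exact ⟨_, rfl, rfl⟩
  · intro u hu v hv h
    by_contra hne
    exact hirr ⟨(u, t), _⟩ ⟨(v, t), _⟩ rfl hne h
  · intro s hs
    rw [← Finset.mem_coe, ← hσ] at hs
    obtain ⟨⟨⟨u, v⟩, huv⟩, rfl, rfl⟩ := hs
    exact ⟨u, (T.graph.mem_neighborFinset _ _).2 huv.symm, rfl⟩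

end STree

end Trees
end AbstractSep

theorem mainTheorem7 {U : Type*} [AbstractSep.SepUniverse U] (S : Set U)
    (hS : AbstractSep.IsSepSystem S) (hsub : AbstractSep.IsStructurallySubmodular S) :
    ∃ (V : Type) (_ : Fintype V) (T : AbstractSep.STree S V),
      T.IsTreeOfTangles ∧ T.IsOverStars ∧
      (∀ P : Set U, AbstractSep.IsRegularProfile S P →
        ∃ t : V, T.IsNodeOf P t ∧ T.degree t = AbstractSep.delta S P) ∧
      (3 < T.maxDegree →
        ∃ P : Set U, AbstractSep.IsRegularProfile S P ∧ T.maxDegree = AbstractSep.delta S P) := by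
  classical
  obtain ⟨τ, hτ, hforced⟩ := AbstractSep.exists_isNodeStar_forall_forced hS hsub
  obtain ⟨L, hL⟩ := AbstractSep.exists_isNodeForest_of_forall (S := S) τ fun y hy => by
    convert (hforced y hy).exists_isNodeForest
  obtain ⟨V, _, T, hirr, hT⟩ := AbstractSep.exists_sTree_of_isNodeForest hS hτ hL
  have hstar : T.IsOverStars := by
    intro t
    obtain ⟨σ, hσ, ht⟩ := hT t
    rw [ht]
    exact hσ.star
  have hsink : ∀ P t (σ : Finset U), T.IsSink P t → T.labelsAt t = σ → (σ : Set U) ⊆ P := by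
    rintro P t σ ht hσ s hs
    rw [← hσ] at hs
    obtain ⟨e, he, rfl⟩ := hs
    exact ht e he
  have hnode : ∀ P : Set U, AbstractSep.IsRegularProfile S P →
      ∃ t : V, T.IsNodeOf P t ∧ T.degree t = AbstractSep.delta S P := by
    intro P hP
    obtain ⟨t, ht⟩ := T.exists_isSink hP
    obtain ⟨σ, hσ, htσ⟩ := hT t
    have hσP := hsink P t σ ht htσ
    refine ⟨t, ⟨ht, fun t' ht' => T.isSink_unique hirr hstar hP ht ht'⟩, ?_⟩
    rw [T.degree_eq_card hirr htσ]
    exact le_antisymm (hσ.card_le_delta P hP hσP) (AbstractSep.delta_le_card σ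
      (hP.distinguishesFromOthers hσP fun Q hQ h => hσ.unique Q P hQ hP h hσP))
  refine ⟨V, inferInstance, T, ⟨hirr, fun P Q hP hQ hne => ?_⟩, hstar, hnode, fun h3 => ?_⟩
  · obtain ⟨t, ht⟩ := T.exists_isSink hP
    obtain ⟨σ, hσ, htσ⟩ := hT t
    have hσP := hsink P t σ ht htσ
    obtain ⟨s, hs, hsQ⟩ := Set.not_subset.1 fun h => hne (hσ.unique P Q hP hQ hσP h)
    have hsT := hs
    rw [← htσ] at hsT
    obtain ⟨e, -, rfl⟩ := hsT
    exact ⟨e, .inl ⟨hσP hs, hQ.inv_mem_of_not_mem (T.label_mem e) hsQ⟩⟩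
  · have := T.isTree.1.nonempty
    obtain ⟨t, ht⟩ := T.graph.exists_maximal_degree_vertex
    have ht' : T.maxDegree = T.degree t := ht
    obtain ⟨σ, hσ, htσ⟩ := hT t
    rw [T.degree_eq_card hirr htσ] at ht'
    -- The maximum degree is at most `delta S P`, which is the degree of the node of `P`.
    obtain ⟨P, hP, hle⟩ := hσ.card_le.resolve_left (by omega)
    obtain ⟨t', -, ht2⟩ := hnode P hP
    have hmax : T.degree t' ≤ T.maxDegree := T.graph.degree_le_maxDegree t'
    exact ⟨P, hP, by omega⟩
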